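/- Let $(\Sigma,h)$ be a smooth Riemannian manifold of dimension $n$ (without boundary) with Levi-Civita connection $D$. A $C^\infty$ function $f:\Sigma\to\mathbb{R}$ is called strictly convex if its Hessian $D_iD_jf$ is positive definite at every point, and uniformly convex if there is a constant $c>0$ such that $V^iV^jD_iD_jf\ge c\,h_{ij}V^iV^j$ for all $V\in T\Sigma$. Suppose that $(\Sigma,h)$ admits a strictly convex or a uniformly convex function. Then $(\Sigma,h)$ admits no closed minimal submanifold of positive dimension. That is, if $S$ is a non-empty compact smooth manifold without boundary, of dimension $k\ge 1$, then there is no smooth immersion $\iota:S\to\Sigma$ (in particular, no embedding) whose mean curvature vector $k^{ab}H_{ab}$ vanishes identically; here $k_{ab}$ is the metric on $S$ induced by $h$, and $H_{ab}$ is the second fundamental form, i.e. the component of $D_{\partial_a}(\iota_*\partial_b)$ orthogonal to $d\iota(TS)$. There is no restriction on the codimension. -/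

import Mathlib

open scoped Manifold ContDiff Bundle

noncomputable section

namespace RiemannianConvexity

/-- The model space `ℝⁿ`. -/
abbrev Eu (n : ℕ) : Type := EuclideanSpace ℝ (Fin n)

/-- The `i`-th standard basis vector of `ℝⁿ`. -/
def stdVec {n : ℕ} (i : Fin n) : Eu n := EuclideanSpace.single i 1

/-- The partial derivative `∂ᵢ F (y)` of a function `F` of `n` real variables. -/
def partialDeriv {n : ℕ} (i : Fin n) (F : Eu n → ℝ) (y : Eu n) : ℝ :=
  fderiv ℝ F y (stdVec i)

section Ambient

variable {n : ℕ} {M : Type*} [TopologicalSpace M] [ChartedSpace (Eu n) M]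

/-- The `i`-th coordinate vector field `∂ᵢ` of the preferred chart `φ` at `x`, at the point
`φ⁻¹ y`. -/
def coordVec (x : M) (y : Eu n) (i : Fin n) :
    TangentSpace (𝓡 n) ((extChartAt (𝓡 n) x).symm y) :=
  mfderiv 𝓘(ℝ, Eu n) (𝓡 n) (extChartAt (𝓡 n) x).symm y (stdVec i)

variable [Bundle.RiemannianBundle (fun x : M => TangentSpace (𝓡 n) x)]

/-- The components `h_{ij} = h(∂ᵢ, ∂ⱼ)` of the metric in the preferred chart `φ` at `x`, at the
point `φ⁻¹ y`. -/
def metricCoeff (x : M) (y : Eu n) : Matrix (Fin n) (Fin n) ℝ :=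
  Matrix.of fun i j => inner ℝ (coordVec x y i) (coordVec x y j)

/-- The Christoffel symbol
`Γ^l_{ij} = ½ h^{lm} (∂ᵢ h_{jm} + ∂ⱼ h_{im} - ∂ₘ h_{ij})` of the Levi-Civita connection at `x`,
in the preferred chart at `x`. -/
def christoffel (x : M) (l i j : Fin n) : ℝ :=
  let y₀ := extChartAt (𝓡 n) x x
  (1 / 2 : ℝ) * ∑ m, (metricCoeff x y₀)⁻¹ l m *
    (partialDeriv i (fun y => metricCoeff x y j m) y₀
      + partialDeriv j (fun y => metricCoeff x y i m) y₀
      - partialDeriv m (fun y => metricCoeff x y i j) y₀)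

/-- The components `DᵢDⱼ f = ∂ᵢ∂ⱼ f - Γ^l_{ij} ∂ₗ f` at `x` of the Hessian of `f` with respect to
the Levi-Civita connection, in the preferred chart at `x`. -/
def hessianCoeff (f : M → ℝ) (x : M) (i j : Fin n) : ℝ :=
  let y₀ := extChartAt (𝓡 n) x x
  let F : Eu n → ℝ := fun y => f ((extChartAt (𝓡 n) x).symm y)
  partialDeriv i (partialDeriv j F) y₀ - ∑ l, christoffel x l i j * partialDeriv l F y₀

/-- The components `Vⁱ` of a tangent vector at `x`, in the preferred chart at `x` (Mathlib's
tangent space at `x` is the model space, a vector being represented in this chart). -/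
def component {x : M} (V : TangentSpace (𝓡 n) x) (i : Fin n) : ℝ :=
  let v : Eu n := V
  v i

/-- The value `Vⁱ Wʲ DᵢDⱼ f` of the Hessian of `f` on two tangent vectors at `x`. -/
def hessian (f : M → ℝ) (x : M) (V W : TangentSpace (𝓡 n) x) : ℝ :=
  ∑ i, ∑ j, component V i * component W j * hessianCoeff f x i j

/-- A smooth function is strictly convex if its Hessian is positive definite at every point. -/
def IsStrictlyConvex (f : M → ℝ) : Prop :=
  ContMDiff (𝓡 n) 𝓘(ℝ, ℝ) ∞ f ∧
    ∀ (x : M) (V : TangentSpace (𝓡 n) x), V ≠ 0 → 0 < hessian f x V V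

/-- A smooth function is uniformly convex if its Hessian is bounded below by a positive constant
multiple of the metric. -/
def IsUniformlyConvex (f : M → ℝ) : Prop :=
  ContMDiff (𝓡 n) 𝓘(ℝ, ℝ) ∞ f ∧
    ∃ c : ℝ, 0 < c ∧
      ∀ (x : M) (V : TangentSpace (𝓡 n) x), c * inner ℝ V V ≤ hessian f x V V

end Ambient

section Submanifold

variable {n k : ℕ} {M : Type*} [TopologicalSpace M] [ChartedSpace (Eu n) M]
  [Bundle.RiemannianBundle (fun x : M => TangentSpace (𝓡 n) x)]
  {S : Type*} [TopologicalSpace S] [ChartedSpace (Eu k) S]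

/-- The `a`-th coordinate vector at `p`, pushed forward by `ι` to a vector tangent to the
image. -/
def pushVec (ι : S → M) (p : S) (a : Fin k) : TangentSpace (𝓡 n) (ι p) :=
  mfderiv (𝓡 k) (𝓡 n) ι p (stdVec a : Eu k)

/-- The components `k_{ab}` at `p` of the metric induced on `S`, in the preferred chart at `p`. -/
def inducedMetric (ι : S → M) (p : S) : Matrix (Fin k) (Fin k) ℝ :=
  Matrix.of fun a b => inner ℝ (pushVec (n := n) ι p a) (pushVec (n := n) ι p b)

/-- The `i`-th coordinate `uⁱ` of `ι`, in the preferred charts at `p` and at `ι p`. -/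
def coordMap (ι : S → M) (p : S) (i : Fin n) (z : Eu k) : ℝ :=
  (extChartAt (𝓡 n) (ι p) (ι ((extChartAt (𝓡 k) p).symm z)) : Eu n) i

/-- The ambient covariant derivative `D_{∂ₐ} (ι_* ∂_b)` at `p`, with components
`∂ₐ∂_b uˡ + Γ^l_{ij} ∂ₐuⁱ ∂_buʲ`. -/
def covDerivAlong (ι : S → M) (p : S) (a b : Fin k) : TangentSpace (𝓡 n) (ι p) :=
  let z₀ := extChartAt (𝓡 k) p p
  WithLp.toLp 2 fun l : Fin n =>
    partialDeriv a (partialDeriv b (coordMap (n := n) ι p l)) z₀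
      + ∑ i, ∑ j, christoffel (ι p) l i j
          * partialDeriv a (coordMap (n := n) ι p i) z₀
          * partialDeriv b (coordMap (n := n) ι p j) z₀

/-- The second fundamental form of `ι` at `p`: the component of `D_{∂ₐ} (ι_* ∂_b)` that is
orthogonal to the tangent space `dι(T_p S)`. -/
def secondFundamentalForm (ι : S → M) (p : S) (a b : Fin k) : TangentSpace (𝓡 n) (ι p) :=
  covDerivAlong (n := n) ι p a b -
    ∑ c : Fin k, ∑ d : Fin k, ((inducedMetric (n := n) ι p)⁻¹ c d
      * inner ℝ (covDerivAlong (n := n) ι p a b) (pushVec (n := n) ι p c))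
      • pushVec (n := n) ι p d

/-- The mean curvature vector at `p`: the trace `k^{ab} H_{ab}` of the second fundamental form. -/
def meanCurvature (ι : S → M) (p : S) : TangentSpace (𝓡 n) (ι p) :=
  ∑ a : Fin k, ∑ b : Fin k, (inducedMetric (n := n) ι p)⁻¹ a b • secondFundamentalForm (n := n) ι p a b

/-- `ι` presents `S` as an (immersed) minimal submanifold: it is a smooth immersion with
vanishing mean curvature. -/
def IsMinimalImmersion (ι : S → M) : Prop :=
  Manifold.IsImmersion (𝓡 k) (𝓡 n) ∞ ι ∧ ∀ p : S, meanCurvature (n := n) (k := k) ι p = 0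

end Submanifold

end RiemannianConvexity

end

/-!
On a compact `S` the continuous function `f ∘ ι` attains its maximum at some point `p`. In the
preferred charts at `p` and `ι p` it becomes `g = F ∘ u`, which has a local maximum, so its gradient
vanishes there and its matrix of second derivatives is negative semidefinite
(`sum_partialDeriv_partialDeriv_nonpos_of_isLocalMax`).

By the second-order chain rule, after inserting the Christoffel symbols of the ambient metric,
`∂ₐ∂_b g = D²f (ι_* ∂ₐ, ι_* ∂_b) + df (D_{∂ₐ} (ι_* ∂_b))`
(`partialDeriv_partialDeriv_comp_chart`). Take the trace with the inverse `k^{ab}` of the induced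
metric. Since `df` vanishes on tangential vectors at `p`, the second term becomes `df` of the mean
curvature vector and drops out for a minimal immersion
(`sum_inv_mul_chartDifferential_covDerivAlong`).

The induced metric is positive definite because the derivative of an immersion is injective
(`mfderiv_injective_of_isImmersion`). Hence `k^{ab}` has the form `∑ c, B c a * B c b` with nonzero
rows `B c` (`exists_eq_sum_mul_of_posDef`), and both traces become sums over the directions
`W c = ∑ a, B c a • ι_* ∂ₐ`: the trace of `∂ₐ∂_b g` is nonpositive, while the trace of `D²f` is
positive because every `W c` is nonzero and `k ≥ 1`. This is a contradiction. Uniform convexity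
implies strict convexity, as the metric is positive definite.
-/

namespace RiemannianConvexity

open Filter Topology

/-! ### Calculus of partial derivatives -/

lemma sum_smul_stdVec {n : ℕ} (v : Eu n) : ∑ i, v i • stdVec i = v := by
  simpa [stdVec] using (EuclideanSpace.basisFun (Fin n) ℝ).sum_repr v

lemma linearIndependent_stdVec {n : ℕ} : LinearIndependent ℝ (stdVec (n := n)) := by
  have h : stdVec (n := n) = EuclideanSpace.basisFun (Fin n) ℝ := by
    ext1 i
    simp [stdVec]
  rw [h]
  exact (EuclideanSpace.basisFun (Fin n) ℝ).orthonormal.linearIndependent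

lemma fderiv_apply_eq_sum_partialDeriv {n : ℕ} (F : Eu n → ℝ) (y v : Eu n) :
    fderiv ℝ F y v = ∑ i, v i * partialDeriv i F y := by
  conv_lhs => rw [← sum_smul_stdVec v]
  simp [partialDeriv]

lemma contDiffAt_partialDeriv {n : ℕ} {F : Eu n → ℝ} {y : Eu n} (hF : ContDiffAt ℝ ∞ F y)
    (i : Fin n) : ContDiffAt ℝ ∞ (partialDeriv i F) y :=
  (hF.fderiv_right (m := ∞) le_rfl).clm_apply contDiffAt_const

lemma differentiableAt_partialDeriv {n : ℕ} {F : Eu n → ℝ} {y : Eu n}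
    (hF : ContDiffAt ℝ ∞ F y) (i : Fin n) : DifferentiableAt ℝ (partialDeriv i F) y :=
  (contDiffAt_partialDeriv hF i).differentiableAt (by simp)

/-- The components of the derivative of a map `ℝᵏ → ℝⁿ` are those of its Jacobian matrix. -/
lemma fderiv_stdVec_apply {k n : ℕ} {u : Eu k → Eu n} {z : Eu k} (hu : DifferentiableAt ℝ u z)
    (a : Fin k) (i : Fin n) :
    fderiv ℝ u z (stdVec a) i = partialDeriv a (fun x => u x i) z := by
  have h : fderiv ℝ (fun x => u x i) z = _ :=
    ((EuclideanSpace.proj i : Eu n →L[ℝ] ℝ).hasFDerivAt.comp z hu.hasFDerivAt).fderiv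
  rw [partialDeriv, h]
  rfl

lemma partialDeriv_comp {k n : ℕ} {F : Eu n → ℝ} {u : Eu k → Eu n} {z : Eu k}
    (hF : DifferentiableAt ℝ F (u z)) (hu : DifferentiableAt ℝ u z) (a : Fin k) :
    partialDeriv a (fun x => F (u x)) z =
      ∑ i, partialDeriv a (fun x => u x i) z * partialDeriv i F (u z) := by
  have h : fderiv ℝ (fun x => F (u x)) z = _ := (hF.hasFDerivAt.comp z hu.hasFDerivAt).fderiv
  rw [partialDeriv, h, ContinuousLinearMap.comp_apply, fderiv_apply_eq_sum_partialDeriv]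
  simp_rw [fderiv_stdVec_apply hu]

/-- The second-order chain rule in coordinates. The derivatives are kept in the order in which they
are taken, so their symmetry is not needed. -/
lemma partialDeriv_partialDeriv_comp {k n : ℕ} {F : Eu n → ℝ} {u : Eu k → Eu n} {z : Eu k}
    (hF : ContDiffAt ℝ ∞ F (u z)) (hu : ContDiffAt ℝ ∞ u z) (a b : Fin k) :
    partialDeriv a (partialDeriv b (fun x => F (u x))) z =
      (∑ i, ∑ j, partialDeriv a (fun x => u x i) z * partialDeriv b (fun x => u x j) z *
          partialDeriv i (partialDeriv j F) (u z)) +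
        ∑ l, partialDeriv a (partialDeriv b (fun x => u x l)) z * partialDeriv l F (u z) := by
  have h1le : (1 : ℕ∞ω) ≤ ∞ := by exact_mod_cast le_top
  have hev : partialDeriv b (fun x => F (u x)) =ᶠ[𝓝 z]
      fun x => ∑ j, partialDeriv b (fun x => u x j) x * partialDeriv j F (u x) := by
    filter_upwards [hu.continuousAt.eventually ((hF.of_le h1le).eventually (by simp)),
      (hu.of_le h1le).eventually (by simp)] with x hFx hux
    exact partialDeriv_comp (hFx.differentiableAt (by simp)) (hux.differentiableAt (by simp)) b
  have hdu := hu.differentiableAt (by simp)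
  have huj (j : Fin n) : ContDiffAt ℝ ∞ (fun x => u x j) z :=
    (contDiffAt_piLp 2).1 hu j
  have h1 (j : Fin n) : DifferentiableAt ℝ (partialDeriv b (fun x => u x j)) z :=
    differentiableAt_partialDeriv (huj j) b
  have h2 (j : Fin n) : DifferentiableAt ℝ (fun x => partialDeriv j F (u x)) z :=
    (differentiableAt_partialDeriv hF j).comp z hdu
  have h3 (j : Fin n) : fderiv ℝ (fun x => partialDeriv j F (u x)) z (stdVec a) =
      ∑ i, partialDeriv a (fun x => u x i) z * partialDeriv i (partialDeriv j F) (u z) :=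
    partialDeriv_comp (differentiableAt_partialDeriv hF j) hdu a
  rw [partialDeriv, hev.fderiv_eq, fderiv_fun_sum fun j _ => (h1 j).fun_mul (h2 j)]
  rw [Finset.sum_comm, ← Finset.sum_add_distrib, sum_apply]
  refine Finset.sum_congr rfl fun j _ => ?_
  rw [fderiv_fun_mul (h1 j) (h2 j)]
  simp only [add_apply, smul_apply, smul_eq_mul, h3, Finset.mul_sum]
  congr 1
  · exact Finset.sum_congr rfl fun i _ => by ring
  · rw [mul_comm]; rfl

/-- The second-order necessary condition at a local maximum, in one variable. -/
lemma deriv_deriv_nonpos_of_isLocalMax {φ : ℝ → ℝ} {t : ℝ} (hc : ContinuousAt φ t)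
    (h : IsLocalMax φ t) : deriv (deriv φ) t ≤ 0 := by
  by_contra! hpos
  -- A positive second derivative would make `t` a local minimum as well, and `φ` locally constant.
  have hmin := isLocalMin_of_deriv_deriv_pos hpos h.deriv_eq_zero hc
  have hconst : φ =ᶠ[𝓝 t] fun _ => φ t := by
    filter_upwards [h, hmin] with x h1 h2 using le_antisymm h1 h2
  have h0 : deriv φ =ᶠ[𝓝 t] fun _ => (0 : ℝ) := by
    simpa using hconst.deriv
  simp [h0.deriv_eq] at hpos

/-- The second-order necessary condition at a local maximum: the Hessian matrix is negative
semidefinite. -/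
lemma sum_partialDeriv_partialDeriv_nonpos_of_isLocalMax {k : ℕ} {g : Eu k → ℝ} {z : Eu k}
    (hg : ContDiffAt ℝ ∞ g z) (h : IsLocalMax g z) (w : Fin k → ℝ) :
    ∑ a, ∑ b, w a * w b * partialDeriv a (partialDeriv b g) z ≤ 0 := by
  set v : Eu k := WithLp.toLp 2 w
  set γ : ℝ → Eu k := fun t => z + t • v
  have hγ0 : γ 0 = z := by simp [γ]
  have hγ (t : ℝ) : HasDerivAt γ v t := by
    simpa only [one_smul] using ((hasDerivAt_id' t).smul_const v).const_add z
  have hγc : Tendsto γ (𝓝 0) (𝓝 z) := by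
    simpa [hγ0] using (hγ 0).continuousAt.tendsto
  have hd {G : Eu k → ℝ} {t : ℝ} (hG : DifferentiableAt ℝ G (γ t)) :
      HasDerivAt (fun s => G (γ s)) (∑ a, w a * partialDeriv a G (γ t)) t := by
    have := hG.hasFDerivAt.comp_hasDerivAt t (hγ t)
    rwa [fderiv_apply_eq_sum_partialDeriv] at this
  have hmax : IsLocalMax (fun t => g (γ t)) 0 := by
    have := hγc.eventually h
    simpa [IsLocalMax, IsMaxFilter, hγ0] using this
  have hcont : ContinuousAt (fun t => g (γ t)) 0 :=
    ContinuousAt.comp (by rw [hγ0]; exact hg.continuousAt) (hγ 0).continuousAt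
  have h1 : deriv (fun t => g (γ t)) =ᶠ[𝓝 0] fun t => ∑ b, w b * partialDeriv b g (γ t) := by
    filter_upwards [hγc.eventually ((hg.of_le (m := 1) (by exact_mod_cast le_top)).eventually
      (by simp))] with t ht
    exact (hd (ht.differentiableAt (by simp))).deriv
  have h2 : HasDerivAt (fun t => ∑ b, w b * partialDeriv b g (γ t))
      (∑ b, w b * ∑ a, w a * partialDeriv a (partialDeriv b g) (γ 0)) 0 :=
    HasDerivAt.fun_sum fun b _ => (hd (by
      rw [hγ0]; exact differentiableAt_partialDeriv hg b)).const_mul (w b)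
  have := deriv_deriv_nonpos_of_isLocalMax hcont hmax
  rw [h1.deriv_eq, h2.deriv, hγ0] at this
  rw [Finset.sum_comm]
  simpa only [Finset.mul_sum, mul_left_comm, mul_assoc] using this

/-! ### Positive definite matrices as sums of squares -/

open scoped MatrixOrder in
/-- A positive definite quadratic form in the dual variables is a sum of squares of nonzero
linear forms. -/
lemma exists_eq_sum_mul_of_posDef {k : ℕ} {A : Matrix (Fin k) (Fin k) ℝ} (hA : A.PosDef) :
    ∃ B : Fin k → Fin k → ℝ, (∀ a b, A a b = ∑ c, B c a * B c b) ∧ ∀ c, B c ≠ 0 := by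
  obtain ⟨B, rfl⟩ := CStarAlgebra.nonneg_iff_eq_star_mul_self.mp hA.posSemidef.nonneg
  refine ⟨B, fun a b => by simp [Matrix.mul_apply, Matrix.star_eq_conjTranspose], fun c hc => ?_⟩
  have h0 : B.det = 0 := Matrix.det_eq_zero_of_row_eq_zero c fun j => congrFun hc j
  have := hA.det_pos
  simp [Matrix.det_mul, h0] at this

/-! ### Immersions -/

/-- The derivative of an immersion is injective: in adapted charts an immersion is the inclusion of
a factor, so the projection onto that factor is a local left inverse. -/
lemma mfderiv_injective_of_isImmersion {n k : ℕ}
    {M : Type*} [TopologicalSpace M] [ChartedSpace (Eu n) M] [IsManifold (𝓡 n) ∞ M]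
    {S : Type*} [TopologicalSpace S] [ChartedSpace (Eu k) S] [IsManifold (𝓡 k) ∞ S]
    {ι : S → M} (hι : Manifold.IsImmersion (𝓡 k) (𝓡 n) ∞ ι) (p : S) :
    Function.Injective (mfderiv (𝓡 k) (𝓡 n) ι p) := by
  have h := hι.isImmersionAt p
  set φ := h.domChart.extend (𝓡 k)
  set ψ := h.codChart.extend (𝓡 n)
  -- The local left inverse: project onto the factor in the adapted charts.
  let r : M → S := fun y => φ.symm (h.equiv.symm (ψ y)).1
  have hφp : p ∈ φ.source := by
    simpa [φ] using h.mem_domChart_source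
  have hsymm : ∀ q ∈ φ.source, (h.equiv.symm (ψ (ι q))).1 = φ q := by
    intro q hq
    have h1 := h.writtenInCharts (φ.map_source hq)
    simp only [Function.comp_apply] at h1
    change ψ (ι (φ.symm (φ q))) = h.equiv (φ q, 0) at h1
    rw [φ.left_inv hq] at h1
    simp [h1]
  have hr : ∀ q ∈ φ.source, r (ι q) = q := by
    intro q hq
    simp [r, hsymm q hq, φ.left_inv hq]
  have hιd : MDifferentiableAt (𝓡 k) (𝓡 n) ι p := h.contMDiffAt.mdifferentiableAt (by simp)
  have hψd : MDifferentiableAt (𝓡 n) 𝓘(ℝ, Eu n) ψ (ι p) :=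
    (h.codChart.contMDiffAt_extend h.codChart_mem_maximalAtlas
      h.mem_codChart_source).mdifferentiableAt (by simp)
  have hφd : MDifferentiableAt 𝓘(ℝ, Eu k) (𝓡 k) φ.symm (φ p) := by
    have h1 := contMDiffOn_extend_symm (I := 𝓡 k) h.domChart_mem_maximalAtlas
    rw [← OpenPartialHomeomorph.extend_target'] at h1
    exact (h1.contMDiffAt (h.domChart.isOpen_extend_target.mem_nhds
      (φ.map_source hφp))).mdifferentiableAt (by simp)
  have hLd : MDifferentiableAt 𝓘(ℝ, Eu n) 𝓘(ℝ, Eu k)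
      (fun y : Eu n => (h.equiv.symm y).1) (ψ (ι p)) :=
    DifferentiableAt.mdifferentiableAt (by fun_prop)
  have hrd : MDifferentiableAt (𝓡 n) (𝓡 k) r (ι p) := by
    refine MDifferentiableAt.comp (I' := 𝓘(ℝ, Eu k)) (ι p) (g := φ.symm)
      (f := fun y => (h.equiv.symm (ψ y)).1) (by rwa [hsymm p hφp]) ?_
    exact MDifferentiableAt.comp (I' := 𝓘(ℝ, Eu n)) (ι p)
      (g := fun y : Eu n => (h.equiv.symm y).1) (f := ψ) hLd hψd
  have hcomp : mfderiv (𝓡 k) (𝓡 k) (r ∘ ι) p = ContinuousLinearMap.id ℝ _ := by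
    have : r ∘ ι =ᶠ[𝓝 p] id := by
      filter_upwards [h.domChart.extend_source_mem_nhds (I := 𝓡 k) h.mem_domChart_source]
        with q hq using hr q hq
    rw [this.mfderiv_eq, mfderiv_id]
  rw [mfderiv_comp p hrd hιd] at hcomp
  exact Function.LeftInverse.injective (g := mfderiv (𝓡 n) (𝓡 k) r (ι p))
    fun v => DFunLike.congr_fun hcomp v

/-! ### Maps and functions in the preferred charts -/

section Restriction

variable {n k : ℕ}
  {M : Type*} [TopologicalSpace M] [ChartedSpace (Eu n) M]
  {S : Type*} [TopologicalSpace S] [ChartedSpace (Eu k) S]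

/-- The map `ι`, written in the preferred charts at `p` and at `ι p`. -/
noncomputable def chartMap (ι : S → M) (p : S) (z : Eu k) : Eu n :=
  extChartAt (𝓡 n) (ι p) (ι ((extChartAt (𝓡 k) p).symm z))

/-- A function `f`, written in the preferred chart at `x`. -/
noncomputable def chartFun (f : M → ℝ) (x : M) (y : Eu n) : ℝ :=
  f ((extChartAt (𝓡 n) x).symm y)

lemma chartMap_self (ι : S → M) (p : S) :
    chartMap (n := n) ι p (extChartAt (𝓡 k) p p) = extChartAt (𝓡 n) (ι p) (ι p) := by
  simp [chartMap]

lemma contDiffAt_chartFun [IsManifold (𝓡 n) ∞ M] {f : M → ℝ}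
    (hf : ContMDiff (𝓡 n) 𝓘(ℝ, ℝ) ∞ f) (x : M) :
    ContDiffAt ℝ ∞ (chartFun (n := n) f x) (extChartAt (𝓡 n) x x) := by
  have h := (contMDiffOn_extChartAt_symm (I := 𝓡 n) (n := ∞) x).contMDiffAt
    (extChartAt_target_mem_nhds x)
  exact (hf.contMDiffAt.comp _ h).contDiffAt

lemma contDiffAt_chartMap [IsManifold (𝓡 n) ∞ M] [IsManifold (𝓡 k) ∞ S] {ι : S → M}
    (hι : ContMDiff (𝓡 k) (𝓡 n) ∞ ι) (p : S) :
    ContDiffAt ℝ ∞ (chartMap (n := n) (k := k) ι p) (extChartAt (𝓡 k) p p) := by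
  have h := (contMDiffAt_iff.1 (hι.contMDiffAt (x := p))).2
  rw [ModelWithCorners.range_eq_univ, contDiffWithinAt_univ] at h
  exact h

/-- In the preferred charts the coordinate vectors are pushed forward by the Jacobian matrix. -/
lemma pushVec_eq_fderiv [IsManifold (𝓡 n) ∞ M] [IsManifold (𝓡 k) ∞ S] {ι : S → M}
    (hι : ContMDiff (𝓡 k) (𝓡 n) ∞ ι) (p : S) (a : Fin k) :
    pushVec (n := n) ι p a =
      fderiv ℝ (chartMap (n := n) (k := k) ι p) (extChartAt (𝓡 k) p p) (stdVec a) := by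
  have h : MDifferentiableAt (𝓡 k) (𝓡 n) ι p := (hι.mdifferentiable (by simp)) p
  rw [pushVec, h.mfderiv, ModelWithCorners.range_eq_univ, fderivWithin_univ]
  rfl

lemma component_pushVec [IsManifold (𝓡 n) ∞ M] [IsManifold (𝓡 k) ∞ S] {ι : S → M}
    (hι : ContMDiff (𝓡 k) (𝓡 n) ∞ ι) (p : S) (a : Fin k) (i : Fin n) :
    component (pushVec (n := n) ι p a) i =
      partialDeriv a (coordMap (n := n) ι p i) (extChartAt (𝓡 k) p p) := by
  rw [pushVec_eq_fderiv hι]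
  exact fderiv_stdVec_apply ((contDiffAt_chartMap hι p).differentiableAt (by simp)) a i

/-- The differential of `f` at `x`, in the preferred chart at `x`. -/
noncomputable def chartDifferential (f : M → ℝ) (x : M) : TangentSpace (𝓡 n) x →ₗ[ℝ] ℝ :=
  (fderiv ℝ (chartFun (n := n) f x) (extChartAt (𝓡 n) x x) : Eu n →ₗ[ℝ] ℝ)

lemma chartDifferential_apply (f : M → ℝ) (x : M) (V : TangentSpace (𝓡 n) x) :
    chartDifferential f x V =
      ∑ i, component V i * partialDeriv i (chartFun (n := n) f x) (extChartAt (𝓡 n) x x) :=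
  fderiv_apply_eq_sum_partialDeriv _ _ _

lemma isLocalMax_chartFun_chartMap [IsManifold (𝓡 n) ∞ M] [IsManifold (𝓡 k) ∞ S] {ι : S → M}
    (hι : ContMDiff (𝓡 k) (𝓡 n) ∞ ι) {f : M → ℝ} {p : S} (hmax : ∀ q, f (ι q) ≤ f (ι p)) :
    IsLocalMax (fun z => chartFun (n := n) f (ι p) (chartMap (k := k) ι p z))
      (extChartAt (𝓡 k) p p) := by
  have hc : Tendsto (fun z => ι ((extChartAt (𝓡 k) p).symm z)) (𝓝 (extChartAt (𝓡 k) p p))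
      (𝓝 (ι p)) := by
    have h := (hι.continuous.tendsto p)
    have h2 := (continuousAt_extChartAt_symm (I := 𝓡 k) p).tendsto
    rw [extChartAt_to_inv] at h2
    exact h.comp h2
  filter_upwards [hc.eventually (extChartAt_source_mem_nhds (I := 𝓡 n) (ι p))] with z hz
  have h1 : (extChartAt (𝓡 n) (ι p)).symm (chartMap (n := n) (k := k) ι p z) = _ :=
    (extChartAt (𝓡 n) (ι p)).left_inv hz
  simp only [chartFun, h1, chartMap_self, extChartAt_to_inv]
  exact hmax _

lemma linearIndependent_pushVec {ι : S → M} {p : S}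
    (h : Function.Injective (mfderiv (𝓡 k) (𝓡 n) ι p)) :
    LinearIndependent ℝ (pushVec (n := n) (k := k) ι p) := by
  let L : Eu k →ₗ[ℝ] TangentSpace (𝓡 n) (ι p) := (mfderiv (𝓡 k) (𝓡 n) ι p).toLinearMap
  exact linearIndependent_stdVec.map' L (LinearMap.ker_eq_bot.2 h)

/-! ### The Hessian of a function restricted to an immersed submanifold -/

lemma sum_sum_comm {α β R : Type*} [Fintype α] [Fintype β] [AddCommMonoid R]
    (F : α → α → β → β → R) :
    ∑ i, ∑ j, ∑ a, ∑ b, F i j a b = ∑ a, ∑ b, ∑ i, ∑ j, F i j a b := by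
  calc _ = ∑ x : α × α, ∑ y : β × β, F x.1 x.2 y.1 y.2 := by simp only [Fintype.sum_prod_type]
    _ = ∑ y : β × β, ∑ x : α × α, F x.1 x.2 y.1 y.2 := Finset.sum_comm
    _ = _ := by simp only [Fintype.sum_prod_type]

variable [Bundle.RiemannianBundle (fun x : M => TangentSpace (𝓡 n) x)]

lemma hessian_sum_smul {f : M → ℝ} {x : M} (w : Fin k → ℝ) (V : Fin k → TangentSpace (𝓡 n) x) :
    hessian f x (∑ a, w a • V a) (∑ a, w a • V a) =
      ∑ a, ∑ b, w a * w b * hessian f x (V a) (V b) := by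
  have hc (i : Fin n) : component (∑ a, w a • V a) i = ∑ a, w a * component (V a) i := by
    let e : TangentSpace (𝓡 n) x →ₗ[ℝ] ℝ := ((EuclideanSpace.proj i : Eu n →L[ℝ] ℝ) : Eu n →ₗ[ℝ] ℝ)
    change e _ = ∑ a, w a * e (V a)
    simp
  simp only [hessian, hc, Finset.sum_mul_sum]
  simp only [Finset.mul_sum, Finset.sum_mul]
  rw [sum_sum_comm]
  refine Finset.sum_congr rfl fun a _ => Finset.sum_congr rfl fun b _ =>
    Finset.sum_congr rfl fun i _ => Finset.sum_congr rfl fun j _ => by ring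

/-- The coordinate Hessian of `f ∘ ι` is the pullback of the Hessian of `f` plus the derivative of
`f` along `D_{∂ₐ} (ι_* ∂_b)`. -/
lemma partialDeriv_partialDeriv_comp_chart [IsManifold (𝓡 n) ∞ M] [IsManifold (𝓡 k) ∞ S]
    {ι : S → M} (hι : ContMDiff (𝓡 k) (𝓡 n) ∞ ι) {f : M → ℝ}
    (hf : ContMDiff (𝓡 n) 𝓘(ℝ, ℝ) ∞ f) (p : S) (a b : Fin k) :
    partialDeriv a (partialDeriv b
        (fun z => chartFun (n := n) f (ι p) (chartMap (k := k) ι p z))) (extChartAt (𝓡 k) p p) =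
      hessian f (ι p) (pushVec (n := n) ι p a) (pushVec (n := n) ι p b) +
        chartDifferential f (ι p) (covDerivAlong (n := n) ι p a b) := by
  rw [partialDeriv_partialDeriv_comp (by
    rw [chartMap_self]; exact contDiffAt_chartFun hf (ι p)) (contDiffAt_chartMap hι p),
    chartDifferential_apply, chartMap_self]
  have hcov (l : Fin n) : component (covDerivAlong (n := n) ι p a b) l =
      partialDeriv a (partialDeriv b (coordMap (n := n) ι p l)) (extChartAt (𝓡 k) p p) +
        ∑ i, ∑ j, christoffel (ι p) l i j *
          partialDeriv a (coordMap (n := n) ι p i) (extChartAt (𝓡 k) p p) *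
          partialDeriv b (coordMap (n := n) ι p j) (extChartAt (𝓡 k) p p) := rfl
  have hH (i j : Fin n) : hessianCoeff f (ι p) i j =
      partialDeriv i (partialDeriv j (chartFun (n := n) f (ι p)))
          (extChartAt (𝓡 n) (ι p) (ι p)) -
        ∑ l, christoffel (ι p) l i j *
          partialDeriv l (chartFun (n := n) f (ι p)) (extChartAt (𝓡 n) (ι p) (ι p)) := rfl
  have hu (i : Fin n) : (fun z => chartMap (n := n) (k := k) ι p z i) = coordMap ι p i := rfl
  simp only [hessian, component_pushVec hι, hcov, hH, hu, mul_sub, add_mul,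
    Finset.sum_sub_distrib, Finset.sum_add_distrib, Finset.sum_mul, Finset.mul_sum]
  -- The Christoffel terms of the Hessian cancel those of the covariant derivative.
  set A : Fin n → ℝ := fun i => partialDeriv a (coordMap (n := n) ι p i) (extChartAt (𝓡 k) p p)
  set B : Fin n → ℝ := fun i => partialDeriv b (coordMap (n := n) ι p i) (extChartAt (𝓡 k) p p)
  set D : Fin n → ℝ := fun l =>
    partialDeriv l (chartFun (n := n) f (ι p)) (extChartAt (𝓡 n) (ι p) (ι p))
  have hcancel : ∑ l, ∑ i, ∑ j, christoffel (ι p) l i j * A i * B j * D l =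
      ∑ i, ∑ j, ∑ l, A i * B j * (christoffel (ι p) l i j * D l) := by
    rw [Finset.sum_comm]
    refine Finset.sum_congr rfl fun i _ => Finset.sum_comm.trans ?_
    exact Finset.sum_congr rfl fun j _ => Finset.sum_congr rfl fun l _ => by ring
  rw [hcancel]
  ring

/-- At a critical point of `f ∘ ι` on a minimal immersed submanifold, the induced trace of
`df (D_{∂ₐ} (ι_* ∂_b))` vanishes: `df` kills tangential vectors there, so this trace is `df` of the
mean curvature vector. -/
lemma sum_inv_mul_chartDifferential_covDerivAlong {ι : S → M} {f : M → ℝ} {p : S}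
    (hH : meanCurvature (n := n) (k := k) ι p = 0)
    (hcrit : ∀ d : Fin k, chartDifferential f (ι p) (pushVec (n := n) ι p d) = 0) :
    ∑ a, ∑ b, (inducedMetric (n := n) (k := k) ι p)⁻¹ a b *
      chartDifferential f (ι p) (covDerivAlong (n := n) ι p a b) = 0 := by
  have h := congrArg (chartDifferential f (ι p)) hH
  simpa [meanCurvature, secondFundamentalForm, hcrit] using h

/-- The induced metric of an immersion is positive definite: it is the Gram matrix of the linearly
independent family of pushed-forward coordinate vectors. -/
lemma posDef_inducedMetric {ι : S → M} {p : S}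
    (h : LinearIndependent ℝ (pushVec (n := n) (k := k) ι p)) :
    (inducedMetric (n := n) (k := k) ι p).PosDef :=
  Matrix.posDef_gram_of_linearIndependent (𝕜 := ℝ) (E := TangentSpace (𝓡 n) (ι p)) h

/-- A strictly convex function attains no maximum on a minimal immersed submanifold of positive
dimension: at a maximum the induced trace of the coordinate Hessian of `f ∘ ι` would be nonpositive,
but it equals the induced trace of the Hessian of `f`, which is positive. -/
lemma not_forall_le_of_isMinimalImmersion [IsManifold (𝓡 n) ∞ M] [IsManifold (𝓡 k) ∞ S]
    (hk : 1 ≤ k) {f : M → ℝ} (hf : IsStrictlyConvex (n := n) f) {ι : S → M}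
    (hι : IsMinimalImmersion (n := n) (k := k) ι) (p : S) : ¬ ∀ q, f (ι q) ≤ f (ι p) := by
  intro hmax
  have hs := hι.1.contMDiff
  have hli := linearIndependent_pushVec (mfderiv_injective_of_isImmersion hι.1 p)
  set z₀ : Eu k := extChartAt (𝓡 k) p p
  set g : Eu k → ℝ := fun z => chartFun (n := n) f (ι p) (chartMap (k := k) ι p z)
  have hu := contDiffAt_chartMap hs p
  have hF : ContDiffAt ℝ ∞ (chartFun (n := n) f (ι p)) (chartMap ι p z₀) := by
    rw [chartMap_self]; exact contDiffAt_chartFun hf.1 (ι p)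
  have hg : ContDiffAt ℝ ∞ g z₀ := hF.comp z₀ hu
  have hlm : IsLocalMax g z₀ := isLocalMax_chartFun_chartMap hs hmax
  have hcrit (d : Fin k) : chartDifferential f (ι p) (pushVec (n := n) ι p d) = 0 := by
    have h1 : partialDeriv d g z₀ = 0 := by simp [partialDeriv, hlm.fderiv_eq_zero]
    rw [chartDifferential_apply, ← h1]
    simp only [component_pushVec hs]
    have := partialDeriv_comp (hF.differentiableAt (by simp)) (hu.differentiableAt (by simp)) d
    rw [this, chartMap_self]
    rfl
  have htr := sum_inv_mul_chartDifferential_covDerivAlong (hι.2 p) hcrit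
  -- The trace with the inverse induced metric is a sum over the directions `W c`.
  obtain ⟨B, hB, hB0⟩ := exists_eq_sum_mul_of_posDef (posDef_inducedMetric hli).inv
  set W : Fin k → TangentSpace (𝓡 n) (ι p) := fun c => ∑ a, B c a • pushVec (n := n) ι p a
  have hW (c : Fin k) : W c ≠ 0 := fun h0 =>
    hB0 c (funext (Fintype.linearIndependent_iff.1 hli (B c) h0))
  have hpos : 0 < ∑ c, hessian f (ι p) (W c) (W c) := by
    have : Nonempty (Fin k) := ⟨⟨0, hk⟩⟩
    exact Finset.sum_pos (fun c _ => hf.2 _ _ (hW c)) Finset.univ_nonempty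
  have hle : ∑ c, ∑ a, ∑ b, B c a * B c b * partialDeriv a (partialDeriv b g) z₀ ≤ 0 :=
    Finset.sum_nonpos fun c _ => sum_partialDeriv_partialDeriv_nonpos_of_isLocalMax hg hlm (B c)
  have heq : ∑ c, ∑ a, ∑ b, B c a * B c b * partialDeriv a (partialDeriv b g) z₀ =
      ∑ c, hessian f (ι p) (W c) (W c) := by
    have h1 : ∑ c, ∑ a, ∑ b, B c a * B c b *
        chartDifferential f (ι p) (covDerivAlong (n := n) ι p a b) = 0 := by
      rw [← htr, Finset.sum_comm]
      refine Finset.sum_congr rfl fun a _ => ?_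
      rw [Finset.sum_comm]
      exact Finset.sum_congr rfl fun b _ => by rw [hB, Finset.sum_mul]
    have h2 (a b : Fin k) := partialDeriv_partialDeriv_comp_chart hs hf.1 p a b
    simp only [g, z₀, h2, W, hessian_sum_smul, mul_add, Finset.sum_add_distrib, h1, add_zero]
  linarith

lemma IsUniformlyConvex.isStrictlyConvex {f : M → ℝ} (hf : IsUniformlyConvex (n := n) f) :
    IsStrictlyConvex (n := n) f := by
  obtain ⟨hs, c, hc, h⟩ := hf
  exact ⟨hs, fun x V hV => (mul_pos hc (real_inner_self_pos.2 hV)).trans_le (h x V)⟩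

end Restriction

end RiemannianConvexity

theorem mainTheorem2 {n : ℕ}
    {M : Type*} [TopologicalSpace M] [ChartedSpace (EuclideanSpace ℝ (Fin n)) M]
    [IsManifold (𝓡 n) ∞ M]
    [Bundle.RiemannianBundle (fun x : M => TangentSpace (𝓡 n) x)]
    [IsContMDiffRiemannianBundle (𝓡 n) ∞ (EuclideanSpace ℝ (Fin n))
      (fun x : M => TangentSpace (𝓡 n) x)]
    (hconv : ∃ f : M → ℝ,
      RiemannianConvexity.IsStrictlyConvex (n := n) f ∨
        RiemannianConvexity.IsUniformlyConvex (n := n) f)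
    {k : ℕ} (hk : 1 ≤ k)
    {S : Type*} [TopologicalSpace S] [CompactSpace S] [Nonempty S]
    [ChartedSpace (EuclideanSpace ℝ (Fin k)) S] [IsManifold (𝓡 k) ∞ S]
    (ι : S → M) :
    ¬ RiemannianConvexity.IsMinimalImmersion (n := n) (k := k) ι := by
  intro hι
  obtain ⟨f, hf⟩ := hconv
  have hf : RiemannianConvexity.IsStrictlyConvex (n := n) f :=
    hf.elim id RiemannianConvexity.IsUniformlyConvex.isStrictlyConvex
  have hc : Continuous fun q => f (ι q) := hf.1.continuous.comp hι.1.contMDiff.continuous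
  obtain ⟨p, -, hp⟩ := isCompact_univ.exists_isMaxOn Set.univ_nonempty hc.continuousOn
  exact RiemannianConvexity.not_forall_le_of_isMinimalImmersion hk hf hι p
    fun q => hp (Set.mem_univ q)
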